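/- Let $(M,g,J)$ be a Hermitian manifold: $M$ is a complex manifold of finite complex dimension $n$ with complex structure $J$, and $g$ is a smooth Riemannian metric with $g(JX,JY)=g(X,Y)$. Put $\Omega(X,Y)=g(X,JY)$ and $d^c\Omega(X,Y,Z)=-d\Omega(JX,JY,JZ)$, where exterior derivatives are normalized by $d\omega(X_0,\dots,X_k)=\sum_i(-1)^iX_i\,\omega(X_0,\dots,\widehat{X_i},\dots,X_k)$ on commuting vector fields. With $\nabla^g$ the Levi-Civita connection, the Bismut connection $\nabla$ and the Chern connection $D$ are defined by $$g(\nabla_XY,Z)=g(\nabla^g_XY,Z)+\tfrac12 d^c\Omega(X,Y,Z),\qquad g(D_XY,Z)=g(\nabla^g_XY,Z)+\tfrac12 d\Omega(JX,Y,Z).$$ Let $T(X,Y)=\nabla_XY-\nabla_YX-[X,Y]$ and $C(X,Y)=D_XY-D_YX-[X,Y]$ be their torsions, with $T(X,Y,Z)=g(T(X,Y),Z)$ and $C(X,Y,Z)=g(C(X,Y),Z)$. Let $R(X,Y,Z,V)=g(\nabla_X\nabla_YZ-\nabla_Y\nabla_XZ-\nabla_{[X,Y]}Z,V)$ be the curvature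 of $\nabla$, and let $K$ be the curvature of $D$, with the same convention. For $x\in M$ and an orthonormal basis $e_1,\dots,e_{2n}$ of $T_xM$, put $$\rho(X,Y)=\tfrac12\sum_iR(X,Y,e_i,Je_i),\qquad \rho^{1,1}(X,Y)=\tfrac12\big(\rho(X,Y)+\rho(JX,JY)\big),$$ $$\kappa(X,Y)=\tfrac12\sum_iK(e_i,Je_i,X,Y),\qquad \lambda^\Omega(X,Y)=\sum_i dT(X,Y,e_i,Je_i),$$ $$\langle i_XC,i_YC\rangle=\sum_{i,j}C(X,e_i,e_j)\,C(Y,e_i,e_j).$$ Then for all $x\in M$ and all $X,Y\in T_xM$, $$\kappa(JX,Y)=\rho^{1,1}(JX,Y)+\langle i_XC,i_YC\rangle-\tfrac14\lambda^\Omega(JX,Y).$$ -/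

import Mathlib

open scoped Manifold ContDiff

noncomputable section

namespace Hermitian

universe u v

section Coordinates

/-! Hermitian geometry in a holomorphic chart: `h` is the coordinate expression of the metric on an
open subset of the complex vector space `E`; the complex structure is multiplication by `i`. -/

variable {E : Type u} [NormedAddCommGroup E] [NormedSpace ℂ E]

variable (E) in
/-- Multiplication by `i`, as a real-linear map. -/
def mulI : E →L[ℝ] E := Complex.I • ContinuousLinearMap.id ℝ E

/-- The Kähler form `Ω(X,Y) = g(X,JY)`. -/
def kahlerForm (h : E → E →L[ℝ] E →L[ℝ] ℝ) (p : E) : E →L[ℝ] E →L[ℝ] ℝ :=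
  (h p).bilinearComp (ContinuousLinearMap.id ℝ E) (mulI E)

/-- The exterior derivative of a 2-form:
`dω(x,y,·) = (∂_x ω)(y,·) - (∂_y ω)(x,·) + (∂_· ω)(x,y)`. -/
def extDerivTwo (w : E → E →L[ℝ] E →L[ℝ] ℝ) (p x y : E) : E →L[ℝ] ℝ :=
  fderiv ℝ w p x y - fderiv ℝ w p y x + ((fderiv ℝ w p).flip x).flip y

/-- The exterior derivative of a 3-form. -/
def extDerivThree (t : E → E → E → E → ℝ) (p x y z w : E) : ℝ :=
  fderiv ℝ (fun q => t q y z w) p x - fderiv ℝ (fun q => t q x z w) p y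
    + fderiv ℝ (fun q => t q x y w) p z - fderiv ℝ (fun q => t q x y z) p w

/-- `d^cΩ(x,y,·) = -dΩ(Jx,Jy,J·)`. -/
def dcKahler (h : E → E →L[ℝ] E →L[ℝ] ℝ) (p x y : E) : E →L[ℝ] ℝ :=
  -(extDerivTwo (kahlerForm h) p (mulI E x) (mulI E y)).comp (mulI E)

/-- The vector `V` such that `g(V,Z) = l(Z)` for all `Z` (for `h p` nondegenerate). -/
def sharp (h : E → E →L[ℝ] E →L[ℝ] ℝ) (p : E) (l : E →L[ℝ] ℝ) : E :=
  (h p).inverse l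

/-- `g(∇^g_x y, ·)` for the Levi-Civita connection `∇^g` and the constant coordinate vector
fields `x`, `y` (Christoffel symbols of the first kind). -/
def leviCivitaLow (h : E → E →L[ℝ] E →L[ℝ] ℝ) (p x y : E) : E →L[ℝ] ℝ :=
  (1 / 2 : ℝ) • (fderiv ℝ h p x y + fderiv ℝ h p y x - ((fderiv ℝ h p).flip x).flip y)

/-- The coefficients of the Bismut connection `g(∇_X Y,Z) = g(∇^g_X Y,Z) + ½ d^cΩ(X,Y,Z)`. -/
def bismutCoeff (h : E → E →L[ℝ] E →L[ℝ] ℝ) (p x y : E) : E :=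
  sharp h p (leviCivitaLow h p x y + (1 / 2 : ℝ) • dcKahler h p x y)

/-- The coefficients of the Chern connection `g(D_X Y,Z) = g(∇^g_X Y,Z) + ½ dΩ(JX,Y,Z)`. -/
def chernCoeff (h : E → E →L[ℝ] E →L[ℝ] ℝ) (p x y : E) : E :=
  sharp h p (leviCivitaLow h p x y + (1 / 2 : ℝ) • extDerivTwo (kahlerForm h) p (mulI E x) y)

/-- The covariant derivative `∇_X Y` of vector fields, for the connection with coefficients `A`. -/
def covDeriv (A : E → E → E → E) (X Y : E → E) : E → E :=
  fun p => fderiv ℝ Y p (X p) + A p (X p) (Y p)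

/-- The torsion `∇_X Y - ∇_Y X - [X,Y]`. -/
def torsion (A : E → E → E → E) (X Y : E → E) : E → E :=
  covDeriv A X Y - covDeriv A Y X - VectorField.lieBracket ℝ X Y

/-- The curvature `R(X,Y)Z = ∇_X ∇_Y Z - ∇_Y ∇_X Z - ∇_{[X,Y]} Z`. -/
def curvature (A : E → E → E → E) (X Y Z : E → E) : E → E :=
  covDeriv A X (covDeriv A Y Z) - covDeriv A Y (covDeriv A X Z)
    - covDeriv A (VectorField.lieBracket ℝ X Y) Z

/-- The torsion as a (0,3)-tensor `g(T(x,y),z)`; vectors are extended to constant coordinate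
vector fields. -/
def torsionLow (h : E → E →L[ℝ] E →L[ℝ] ℝ) (A : E → E → E → E) (p x y z : E) : ℝ :=
  h p (torsion A (fun _ => x) (fun _ => y) p) z

/-- The curvature as a (0,4)-tensor `g(R(x,y)z,w)`; vectors are extended to constant coordinate
vector fields. -/
def curvatureLow (h : E → E →L[ℝ] E →L[ℝ] ℝ) (A : E → E → E → E) (p x y z w : E) : ℝ :=
  h p (curvature A (fun _ => x) (fun _ => y) (fun _ => z) p) w

end Coordinates

section Manifold

variable {E : Type u} [NormedAddCommGroup E] [NormedSpace ℂ E]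
variable {M : Type v} [TopologicalSpace M] [ChartedSpace E M]

/-- A complex manifold is in particular a smooth real manifold. -/
instance instIsManifoldReal [IsManifold 𝓘(ℂ, E) ω M] : IsManifold 𝓘(ℝ, E) ∞ M := by
  refine isManifold_of_contDiffOn 𝓘(ℝ, E) ∞ M fun e e' he he' => ?_
  have h := (contDiffGroupoid ω 𝓘(ℂ, E)).compatible he he'
  rw [contDiffGroupoid, mem_groupoid_of_pregroupoid] at h
  have h1 := h.1
  simp only [contDiffPregroupoid, modelWithCornersSelf_coe, modelWithCornersSelf_coe_symm,
    Function.comp_id, Function.id_comp, Set.preimage_id, Set.range_id, Set.inter_univ] at h1 ⊢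
  exact (h1.restrict_scalars ℝ).of_le le_top

/-- The complex structure on the (real) tangent spaces of a complex manifold. A tangent vector at
`x` is represented by an element of `E` through the preferred chart at `x`, which is holomorphic,
so `J` is multiplication by `i` on this representative. -/
def J (x : M) : TangentSpace 𝓘(ℝ, E) x →L[ℝ] TangentSpace 𝓘(ℝ, E) x := mulI E

variable (E M) in
/-- A smooth Hermitian metric on a complex manifold: a smooth Riemannian metric with
`g(JX,JY) = g(X,Y)`. -/
structure HermitianMetric [IsManifold 𝓘(ℂ, E) ω M] where
  /-- The underlying Riemannian metric. -/
  toRiemannianMetric : Bundle.ContMDiffRiemannianMetric 𝓘(ℝ, E) ∞ E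
    (fun x : M => TangentSpace 𝓘(ℝ, E) x)
  compatible : ∀ (x : M) (X Y : TangentSpace 𝓘(ℝ, E) x),
    toRiemannianMetric.inner x (J x X) (J x Y) = toRiemannianMetric.inner x X Y

variable [IsManifold 𝓘(ℂ, E) ω M]

/-- The inner product `g(X,Y)` of tangent vectors. -/
def HermitianMetric.inner (g : HermitianMetric E M) (x : M) (X Y : TangentSpace 𝓘(ℝ, E) x) : ℝ :=
  g.toRiemannianMetric.inner x X Y

/-- The coordinate expression of the metric in the chart `φ`: the pull-back of `g` by `φ⁻¹`. -/
def coordMetric (g : HermitianMetric E M) (φ : OpenPartialHomeomorph M E) (p : E) :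
    E →L[ℝ] E →L[ℝ] ℝ :=
  let G : E →L[ℝ] E →L[ℝ] ℝ := g.toRiemannianMetric.inner (φ.symm p)
  let A : E →L[ℝ] E := mfderiv 𝓘(ℝ, E) 𝓘(ℝ, E) φ.symm p
  G.bilinearComp A A

/-- The coordinate representative of a tangent vector in the chart `φ`. -/
def coord (φ : OpenPartialHomeomorph M E) (x : M) (X : TangentSpace 𝓘(ℝ, E) x) : E :=
  mfderiv 𝓘(ℝ, E) 𝓘(ℝ, E) φ x X

variable (g : HermitianMetric E M) (φ : OpenPartialHomeomorph M E) (x : M)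

/-! The tensors below are computed in a holomorphic chart `φ` around `x`. -/

/-- The curvature `R(X,Y,Z,V) = g(R(X,Y)Z,V)` of the Bismut connection. -/
def bismutCurvature (X Y Z V : TangentSpace 𝓘(ℝ, E) x) : ℝ :=
  curvatureLow (coordMetric g φ) (bismutCoeff (coordMetric g φ)) (φ x)
    (coord φ x X) (coord φ x Y) (coord φ x Z) (coord φ x V)

/-- The curvature `K(X,Y,Z,V) = g(K(X,Y)Z,V)` of the Chern connection. -/
def chernCurvature (X Y Z V : TangentSpace 𝓘(ℝ, E) x) : ℝ :=
  curvatureLow (coordMetric g φ) (chernCoeff (coordMetric g φ)) (φ x)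
    (coord φ x X) (coord φ x Y) (coord φ x Z) (coord φ x V)

/-- The torsion `C(X,Y,Z) = g(C(X,Y),Z)` of the Chern connection. -/
def chernTorsion (X Y Z : TangentSpace 𝓘(ℝ, E) x) : ℝ :=
  torsionLow (coordMetric g φ) (chernCoeff (coordMetric g φ)) (φ x)
    (coord φ x X) (coord φ x Y) (coord φ x Z)

/-- The exterior derivative `dT` of the torsion 3-form `T(X,Y,Z) = g(T(X,Y),Z)` of the Bismut
connection. -/
def dBismutTorsion (X Y Z V : TangentSpace 𝓘(ℝ, E) x) : ℝ :=
  extDerivThree (torsionLow (coordMetric g φ) (bismutCoeff (coordMetric g φ))) (φ x)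
    (coord φ x X) (coord φ x Y) (coord φ x Z) (coord φ x V)

/-! Traces; `e` stands for an orthonormal basis of the tangent space at `x`. -/

variable {ι : Type*} [Fintype ι] {x} (e : Module.Basis ι ℝ (TangentSpace 𝓘(ℝ, E) x))

/-- The Ricci form of the Bismut connection, `ρ(X,Y) = ½ ∑ R(X,Y,eᵢ,Jeᵢ)`. -/
def bismutRicciForm (X Y : TangentSpace 𝓘(ℝ, E) x) : ℝ :=
  (1 / 2) * ∑ i, bismutCurvature g φ x X Y (e i) (J x (e i))

/-- The (1,1)-part of the Ricci form of the Bismut connection. -/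
def bismutRicciForm11 (X Y : TangentSpace 𝓘(ℝ, E) x) : ℝ :=
  (1 / 2) * (bismutRicciForm g φ e X Y + bismutRicciForm g φ e (J x X) (J x Y))

/-- The mean curvature of the Chern connection, `κ(X,Y) = ½ ∑ K(eᵢ,Jeᵢ,X,Y)`. -/
def meanCurvature (X Y : TangentSpace 𝓘(ℝ, E) x) : ℝ :=
  (1 / 2) * ∑ i, chernCurvature g φ x (e i) (J x (e i)) X Y

/-- `λ^Ω(X,Y) = ∑ dT(X,Y,eᵢ,Jeᵢ)`. -/
def lambdaForm (X Y : TangentSpace 𝓘(ℝ, E) x) : ℝ :=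
  ∑ i, dBismutTorsion g φ x X Y (e i) (J x (e i))

/-- `⟨i_X C, i_Y C⟩`, the scalar product of the 2-tensors `C(X,·,·)` and `C(Y,·,·)`. -/
def torsionInner (X Y : TangentSpace 𝓘(ℝ, E) x) : ℝ :=
  ∑ i, ∑ j, chernTorsion g φ x X (e i) (e j) * chernTorsion g φ x Y (e i) (e j)

end Manifold

end Hermitian

end

open scoped Topology

noncomputable section

set_option maxSynthPendingDepth 3

namespace Hermitian

/-! ### Connection coefficients of Hermitian metrics in holomorphic coordinates. -/

section Flat

variable {E : Type*} [NormedAddCommGroup E] [NormedSpace ℂ E]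

/-! In a holomorphic chart `J` is constant, so each term of the identity splits into a part linear
in the second derivatives of the metric `h` and a part quadratic in connection coefficients. The two
parts are compared separately.

For constant fields write `A_x v = D_v x` and `S_x v = ∇_x v - D_v x`. The map `S_x` is the
`g`-adjoint of `C(x,·)`. Moreover `A` is complex linear in `x` and `S` is antilinear, so `∇_x = A_x
+ S_x` while `∇_{Jx} = J(A_x - S_x)` (`bismutCoeff_mulI_left`). In the (1,1)-part of the Bismut
Ricci form the cross terms therefore cancel, leaving `∑ ⟨A_x eᵢ, A_y eᵢ⟩ - ∑ ⟨S_x eᵢ, S_y eᵢ⟩`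
(`bismutCoeff_quadratic`). The first sum is the quadratic part of `κ(Jx,y)`
(`sum_curvatureLow_chernCoeff`), and the second is `⟨i_x C, i_y C⟩`, since adjoints have the same
Hilbert–Schmidt products (`sum_torsionLow_chernCoeff`).

The Bismut torsion is `d^cΩ`, which is linear in the first derivatives of `h`, so `dT` has no
quadratic part. Its trace supplies the term `∑ ∂_{eᵢ}∂_{eᵢ} h(x,y)` of `κ` and cancels the second
derivatives in the Ricci form (`sum_extDerivThree_bismutCoeff`). The result transfers to the
manifold because a holomorphic chart is an isometry onto its coordinate metric and its differential
commutes with `J`. -/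

@[simp] lemma mulI_mulI (x : E) : mulI E (mulI E x) = -x := by
  simp [mulI, smul_smul]

/-- `h` is the coordinate expression of a smooth Hermitian metric on the open set `U`. -/
structure IsHermitianOn (h : E → E →L[ℝ] E →L[ℝ] ℝ) (U : Set E) : Prop where
  isOpen : IsOpen U
  contDiffOn : ContDiffOn ℝ ∞ h U
  symm : ∀ q ∈ U, ∀ u v, h q u v = h q v u
  compat : ∀ q ∈ U, ∀ u v, h q (mulI E u) (mulI E v) = h q u v
  pos : ∀ q ∈ U, ∀ u, u ≠ 0 → 0 < h q u u

namespace IsHermitianOn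

variable {h : E → E →L[ℝ] E →L[ℝ] ℝ} {U : Set E} (H : IsHermitianOn h U) {q : E} (hq : q ∈ U)

include H hq

lemma contDiffAt : ContDiffAt ℝ ∞ h q := H.contDiffOn.contDiffAt (H.isOpen.mem_nhds hq)

lemma differentiableAt : DifferentiableAt ℝ h q :=
  (H.contDiffAt hq).differentiableAt (by simp)

lemma contDiffAt_fderiv : ContDiffAt ℝ ∞ (fderiv ℝ h) q :=
  (H.contDiffAt hq).fderiv_right (by simp)

lemma differentiableAt_fderiv : DifferentiableAt ℝ (fderiv ℝ h) q :=
  (H.contDiffAt_fderiv hq).differentiableAt (by simp)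

lemma mulI_left (u v : E) : h q (mulI E u) v = -h q u (mulI E v) := by
  have := H.compat q hq u (mulI E v)
  simp at this
  linarith

lemma ext_low {u v : E} (huv : ∀ w, h q u w = h q v w) : u = v := by
  by_contra hne
  have := H.pos q hq (u - v) (sub_ne_zero.2 hne)
  simp [huv] at this

omit hq in
lemma eventually_mem (hq : q ∈ U) : ∀ᶠ r in 𝓝 q, r ∈ U := H.isOpen.mem_nhds hq

lemma fderiv_apply (x u v : E) : fderiv ℝ (fun r => h r u v) q x = fderiv ℝ h q x u v := by
  have h1 := H.differentiableAt hq
  rw [fderiv_clm_apply (h1.clm_apply (differentiableAt_const u)) (differentiableAt_const v),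
    fderiv_clm_apply h1 (differentiableAt_const u)]
  simp

lemma fderiv_symm (x u v : E) : fderiv ℝ h q x u v = fderiv ℝ h q x v u := by
  rw [← H.fderiv_apply hq, ← H.fderiv_apply hq]
  refine congrArg (fun l : E →L[ℝ] ℝ => l x) (Filter.EventuallyEq.fderiv_eq ?_)
  filter_upwards [H.eventually_mem hq] with r hr using H.symm r hr u v

lemma fderiv_compat (x u v : E) :
    fderiv ℝ h q x (mulI E u) (mulI E v) = fderiv ℝ h q x u v := by
  rw [← H.fderiv_apply hq, ← H.fderiv_apply hq]
  refine congrArg (fun l : E →L[ℝ] ℝ => l x) (Filter.EventuallyEq.fderiv_eq ?_)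
  filter_upwards [H.eventually_mem hq] with r hr using H.compat r hr u v

lemma fderiv_mulI_left (x u v : E) :
    fderiv ℝ h q x (mulI E u) v = -fderiv ℝ h q x u (mulI E v) := by
  have := H.fderiv_compat hq x u (mulI E v)
  simp at this
  linarith

lemma fderiv_mulI_right (x u v : E) :
    fderiv ℝ h q x v (mulI E u) = -fderiv ℝ h q x u (mulI E v) := by
  rw [H.fderiv_symm hq, H.fderiv_mulI_left hq]

lemma hasFDerivAt_fderiv_apply (u v w : E) :
    HasFDerivAt (fun r => fderiv ℝ h r u v w)
      ((((fderiv ℝ (fderiv ℝ h) q).flip u).flip v).flip w) q := by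
  have h1 := (H.differentiableAt_fderiv hq).hasFDerivAt
  have h2 := ((h1.clm_apply (hasFDerivAt_const u q)).clm_apply
    (hasFDerivAt_const v q)).clm_apply (hasFDerivAt_const w q)
  refine h2.congr_fderiv ?_
  ext x
  simp

lemma fderiv_fderiv_apply (x u v w : E) :
    fderiv ℝ (fun r => fderiv ℝ h r u v w) q x = fderiv ℝ (fderiv ℝ h) q x u v w := by
  rw [(H.hasFDerivAt_fderiv_apply hq u v w).fderiv]
  simp

lemma sndFDeriv_symm (x u v w : E) :
    fderiv ℝ (fderiv ℝ h) q x u v w = fderiv ℝ (fderiv ℝ h) q x u w v := by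
  rw [← H.fderiv_fderiv_apply hq, ← H.fderiv_fderiv_apply hq]
  refine congrArg (fun l : E →L[ℝ] ℝ => l x) (Filter.EventuallyEq.fderiv_eq ?_)
  filter_upwards [H.eventually_mem hq] with r hr using H.fderiv_symm hr u v w

lemma sndFDeriv_compat (x u v w : E) :
    fderiv ℝ (fderiv ℝ h) q x u (mulI E v) (mulI E w) = fderiv ℝ (fderiv ℝ h) q x u v w := by
  rw [← H.fderiv_fderiv_apply hq, ← H.fderiv_fderiv_apply hq]
  refine congrArg (fun l : E →L[ℝ] ℝ => l x) (Filter.EventuallyEq.fderiv_eq ?_)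
  filter_upwards [H.eventually_mem hq] with r hr using H.fderiv_compat hr u v w

lemma sndFDeriv_mulI_left (x u v w : E) :
    fderiv ℝ (fderiv ℝ h) q x u (mulI E v) w = -fderiv ℝ (fderiv ℝ h) q x u v (mulI E w) := by
  have := H.sndFDeriv_compat hq x u v (mulI E w)
  simp at this
  linarith

lemma sndFDeriv_comm (x y u v : E) :
    fderiv ℝ (fderiv ℝ h) q x y u v = fderiv ℝ (fderiv ℝ h) q y x u v := by
  have : IsSymmSndFDerivAt ℝ h q :=
    (H.contDiffAt hq).isSymmSndFDerivAt (by simpa using WithTop.coe_le_coe.2 (le_top (a := (2 : ℕ∞))))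
  rw [this.eq]

lemma fderiv_kahlerForm (x y z : E) :
    fderiv ℝ (kahlerForm h) q x y z = fderiv ℝ h q x y (mulI E z) := by
  -- Putting `J` into the second slot is a fixed continuous linear operator on bilinear forms, so it
  -- commutes with differentiation.
  let L := (ContinuousLinearMap.compL ℝ E (E →L[ℝ] ℝ) (E →L[ℝ] ℝ))
    ((ContinuousLinearMap.compL ℝ E E ℝ).flip (mulI E))
  have key : kahlerForm h = L ∘ h := by
    funext r
    ext y z
    simp [kahlerForm, L]
  rw [key, (L.hasFDerivAt.comp q (H.differentiableAt hq).hasFDerivAt).fderiv]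
  simp [L]

end IsHermitianOn

/-- The coefficients `g(D_x y, z)` of the Chern connection in holomorphic coordinates. -/
def chernLow (h : E → E →L[ℝ] E →L[ℝ] ℝ) (p x y z : E) : ℝ :=
  (1 / 2) * (fderiv ℝ h p x y z + fderiv ℝ h p (mulI E x) y (mulI E z))

/-- The form `d^cΩ(x,y,z)` in terms of the derivative of the metric. -/
def dcLow (h : E → E →L[ℝ] E →L[ℝ] ℝ) (p x y z : E) : ℝ :=
  fderiv ℝ h p (mulI E x) (mulI E y) z - fderiv ℝ h p (mulI E y) (mulI E x) z
    + fderiv ℝ h p (mulI E z) (mulI E x) y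

/-- The coefficients `g(∇_x y, z)` of the Bismut connection in holomorphic coordinates. -/
def bismutLow (h : E → E →L[ℝ] E →L[ℝ] ℝ) (p x y z : E) : ℝ :=
  chernLow h p y x z + chernLow h p x z y - chernLow h p z x y

namespace IsHermitianOn

variable {h : E → E →L[ℝ] E →L[ℝ] ℝ} {U : Set E} (H : IsHermitianOn h U) {q : E} (hq : q ∈ U)

include H hq

/-- By `J`-invariance of the metric, two terms of `dΩ(Jx,y,z)` cancel the last two Levi-Civita
terms. -/
lemma chernLow_eq (x y z : E) :
    (leviCivitaLow h q x y + (1 / 2 : ℝ) • extDerivTwo (kahlerForm h) q (mulI E x) y) z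
      = chernLow h q x y z := by
  simp [leviCivitaLow, extDerivTwo, chernLow, H.fderiv_kahlerForm hq, H.fderiv_mulI_left hq]
  ring

lemma dcKahler_eq (x y z : E) : dcKahler h q x y z = dcLow h q x y z := by
  simp [dcKahler, extDerivTwo, dcLow, H.fderiv_kahlerForm hq, H.fderiv_mulI_left hq]
  ring

lemma bismutLow_eq (x y z : E) :
    (leviCivitaLow h q x y + (1 / 2 : ℝ) • dcKahler h q x y) z = bismutLow h q x y z := by
  rw [add_apply, smul_apply, H.dcKahler_eq hq]
  simp only [leviCivitaLow, dcLow, bismutLow, chernLow, add_apply,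
    sub_apply, smul_apply,
    ContinuousLinearMap.flip_apply, smul_eq_mul]
  -- Instances at fixed vectors give every derivative one normal form: slots in alphabetical order,
  -- `J` on the last slot.
  have s2 := fun r => H.fderiv_symm hq r z y
  have s6 := fun r => H.fderiv_mulI_right hq r y z
  simp only [H.fderiv_mulI_left hq, s2, s6]
  ring

omit H hq in
lemma chernLow_mulI_left (x y z : E) :
    chernLow h q (mulI E x) y z = -chernLow h q x y (mulI E z) := by
  simp [chernLow]
  ring

lemma chernLow_mulI_mid (x y z : E) :
    chernLow h q x (mulI E y) z = -chernLow h q x y (mulI E z) := by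
  simp [chernLow, H.fderiv_mulI_left hq]
  ring

/-- The `∂_{Jx}` terms drop out because `h(·,J·)` is skew. -/
lemma chernLow_metric (x y z : E) :
    chernLow h q x y z + chernLow h q x z y = fderiv ℝ h q x y z := by
  simp only [chernLow, H.fderiv_symm hq _ z y, H.fderiv_mulI_right hq _ y z]
  ring

lemma bismutLow_metric (x y z : E) :
    bismutLow h q x y z + bismutLow h q x z y = fderiv ℝ h q x y z := by
  rw [← H.chernLow_metric hq]
  simp only [bismutLow]
  ring

lemma bismutLow_torsion (x y z : E) :
    bismutLow h q x y z - bismutLow h q y x z = dcLow h q x y z := by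
  have s1 := fun r => H.fderiv_symm hq r z x
  have s2 := fun r => H.fderiv_symm hq r z y
  have s3 := fun r => H.fderiv_symm hq r y x
  have s4 := fun r => H.fderiv_mulI_right hq r x y
  have s5 := fun r => H.fderiv_mulI_right hq r x z
  have s6 := fun r => H.fderiv_mulI_right hq r y z
  simp only [dcLow, bismutLow, chernLow, H.fderiv_mulI_left hq, s1, s2, s3, s4, s5, s6]
  ring

end IsHermitianOn

end Flat

/-! ### Curvature and torsion through lowered coefficients. -/

section FlatCurvature

variable {E : Type*} [NormedAddCommGroup E] [NormedSpace ℂ E]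

namespace IsHermitianOn

variable {h : E → E →L[ℝ] E →L[ℝ] ℝ} {U : Set E} (H : IsHermitianOn h U) {q : E} (hq : q ∈ U)

include H

lemma contDiffOn_fderiv_apply (x y z : E) :
    ContDiffOn ℝ ∞ (fun r => fderiv ℝ h r x y z) U := fun _ hr =>
  ((((H.contDiffAt_fderiv hr).clm_apply contDiffAt_const).clm_apply contDiffAt_const).clm_apply
    contDiffAt_const).contDiffWithinAt

lemma contDiffOn_chernLow (x y z : E) : ContDiffOn ℝ ∞ (fun r => chernLow h r x y z) U :=
  contDiffOn_const.mul
    ((H.contDiffOn_fderiv_apply _ _ _).add (H.contDiffOn_fderiv_apply _ _ _))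

lemma contDiffOn_bismutLow (x y z : E) : ContDiffOn ℝ ∞ (fun r => bismutLow h r x y z) U :=
  ((H.contDiffOn_chernLow _ _ _).add (H.contDiffOn_chernLow _ _ _)).sub
    (H.contDiffOn_chernLow _ _ _)

include hq

lemma fderiv_chernLow (v x y z : E) :
    fderiv ℝ (fun r => chernLow h r x y z) q v = (1 / 2) * (fderiv ℝ (fderiv ℝ h) q v x y z
      + fderiv ℝ (fderiv ℝ h) q v (mulI E x) y (mulI E z)) := by
  refine (congrArg (fun l : E →L[ℝ] ℝ => l v) (((H.hasFDerivAt_fderiv_apply hq x y z).add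
    (H.hasFDerivAt_fderiv_apply hq (mulI E x) y (mulI E z))).const_mul (1 / 2)).fderiv).trans ?_
  simp
  ring

lemma fderiv_bismutLow (v x y z : E) :
    fderiv ℝ (fun r => bismutLow h r x y z) q v = fderiv ℝ (fun r => chernLow h r y x z) q v
      + fderiv ℝ (fun r => chernLow h r x z y) q v
      - fderiv ℝ (fun r => chernLow h r z x y) q v := by
  have d := fun x y z => ((H.contDiffOn_chernLow x y z).contDiffAt
    (H.isOpen.mem_nhds hq)).differentiableAt (by simp)
  refine (congrArg (fun l : E →L[ℝ] ℝ => l v) (((d y x z).hasFDerivAt.add (d x z y).hasFDerivAt).sub (d z x y).hasFDerivAt).fderiv).trans ?_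
  simp

lemma fderiv_dcLow (v x y z : E) :
    fderiv ℝ (fun r => dcLow h r x y z) q v
      = fderiv ℝ (fderiv ℝ h) q v (mulI E x) (mulI E y) z
        - fderiv ℝ (fderiv ℝ h) q v (mulI E y) (mulI E x) z
        + fderiv ℝ (fderiv ℝ h) q v (mulI E z) (mulI E x) y := by
  refine (congrArg (fun l : E →L[ℝ] ℝ => l v) (((H.hasFDerivAt_fderiv_apply hq (mulI E x) (mulI E y) z).sub
    (H.hasFDerivAt_fderiv_apply hq (mulI E y) (mulI E x) z)).add
    (H.hasFDerivAt_fderiv_apply hq (mulI E z) (mulI E x) y)).fderiv).trans ?_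
  simp

variable [FiniteDimensional ℝ E]

/-- `sharp` uses `ContinuousLinearMap.inverse`, which defaults to zero on non-invertible maps.
Definiteness and equality of dimensions exclude that case. -/
lemma isInvertible : (h q).IsInvertible := by
  have hinj : Function.Injective (h q : E →ₗ[ℝ] E →L[ℝ] ℝ) := fun u v huv =>
    H.ext_low hq fun w => congrArg (fun l : E →L[ℝ] ℝ => l w) huv
  have hrank : Module.finrank ℝ E = Module.finrank ℝ (E →L[ℝ] ℝ) := by
    rw [← (LinearMap.toContinuousLinearMap (𝕜 := ℝ) (E := E) (F' := ℝ)).finrank_eq]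
    exact Subspace.dual_finrank_eq.symm
  refine ⟨(LinearEquiv.ofInjectiveOfFinrankEq _ hinj hrank).toContinuousLinearEquiv, ?_⟩
  ext u v
  rfl

lemma sharp_apply (l : E →L[ℝ] ℝ) (w : E) : h q (sharp h q l) w = l w := by
  obtain ⟨e, he⟩ := H.isInvertible hq
  simp [sharp, ← he]

omit H hq [FiniteDimensional ℝ E] in
lemma sharp_zero : sharp h q 0 = 0 := by simp [sharp]

lemma differentiableAt_sharp {l : E → E →L[ℝ] ℝ} (hl : DifferentiableAt ℝ l q) :
    DifferentiableAt ℝ (fun r => sharp h r (l r)) q := by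
  have h1 : DifferentiableAt ℝ (fun r => (h r).inverse) q :=
    (((H.isInvertible hq).contDiffAt_map_inverse (n := 1)).differentiableAt (by simp)).comp q
      (H.differentiableAt hq)
  exact h1.clm_apply hl

/-- Differentiating the defining identity `h(sharp l, w) = l w` by the product rule avoids any
formula for the derivative of the inverse. -/
lemma fderiv_sharp {l : E → E →L[ℝ] ℝ} (hl : DifferentiableAt ℝ l q) (x w : E) :
    h q (fderiv ℝ (fun r => sharp h r (l r)) q x) w
      = fderiv ℝ (fun r => l r w) q x - fderiv ℝ h q x (sharp h q (l q)) w := by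
  have h1 := (((H.differentiableAt hq).hasFDerivAt.clm_apply
    (H.differentiableAt_sharp hq hl).hasFDerivAt).clm_apply (hasFDerivAt_const w q)).fderiv
  have h2 : fderiv ℝ (fun r => h r (sharp h r (l r)) w) q = fderiv ℝ (fun r => l r w) q := by
    refine Filter.EventuallyEq.fderiv_eq ?_
    filter_upwards [H.eventually_mem hq] with r hr using H.sharp_apply hr _ _
  have h3 := congrArg (fun L : E →L[ℝ] ℝ => L x) (h2.symm.trans h1)
  simp at h3
  linarith

/-- The curvature of a metric connection in terms of its lowered coefficients. -/
lemma curvatureLow_eq {L : E → E → E → E →L[ℝ] ℝ} {A : E → E → E → E}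
    (hA : ∀ r x y, A r x y = sharp h r (L r x y))
    (hdiff : ∀ y z, DifferentiableAt ℝ (fun r => L r y z) q)
    (hzero : ∀ z, L q 0 z = 0)
    (hmet : ∀ x y z, L q x y z + L q x z y = fderiv ℝ h q x y z) (x y z w : E) :
    curvatureLow h A q x y z w
      = fderiv ℝ (fun r => L r y z w) q x - fderiv ℝ (fun r => L r x z w) q y
        - h q (A q x w) (A q y z) + h q (A q y w) (A q x z) := by
  have hcov : ∀ y z : E, covDeriv A (fun _ => y) (fun _ => z) = fun r => A r y z := by
    intro y z
    funext r
    simp [covDeriv]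
  have hbr : VectorField.lieBracket ℝ (fun _ : E => x) (fun _ : E => y) = fun _ => 0 := by
    funext r
    simp [VectorField.lieBracket]
  have hlow : ∀ x y z, h q (A q x y) z = L q x y z := fun x y z => by
    rw [hA, H.sharp_apply hq]
  -- Metric compatibility turns `L(x, A_y z, w) - ∂_x h(A_y z, w)` into `-L(x, w, A_y z)`.
  have hder : ∀ x y, h q (fderiv ℝ (fun r => A r y z) q x) w + h q (A q x (A q y z)) w
      = fderiv ℝ (fun r => L r y z w) q x - h q (A q x w) (A q y z) := by
    intro x y
    have h1 := H.fderiv_sharp hq (hdiff y z) x w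
    simp only [← hA] at h1
    rw [h1, hlow, hlow, ← hmet]
    ring
  have e1 := hder x y
  have e2 := hder y x
  simp only [curvatureLow, curvature, hcov, hbr, Pi.sub_apply]
  simp only [covDeriv, map_sub, map_add, sub_apply, add_apply]
  -- The bracket term has become `A q 0 z`. Since `L` is not assumed linear in its direction slot,
  -- its vanishing needs `hzero`.
  rw [hA q 0 z, hzero, sharp_zero]
  simp
  linarith

omit H hq [FiniteDimensional ℝ E] in
lemma torsionLow_eq {A : E → E → E → E} (x y z : E) :
    torsionLow h A q x y z = h q (A q x y) z - h q (A q y x) z := by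
  simp [torsionLow, torsion, covDeriv, VectorField.lieBracket]

lemma chernCoeff_apply (x y z : E) : h q (chernCoeff h q x y) z = chernLow h q x y z := by
  rw [chernCoeff, H.sharp_apply hq, H.chernLow_eq hq]

lemma bismutCoeff_apply (x y z : E) : h q (bismutCoeff h q x y) z = bismutLow h q x y z := by
  rw [bismutCoeff, H.sharp_apply hq, H.bismutLow_eq hq]

lemma curvatureLow_chernCoeff (x y z w : E) :
    curvatureLow h (chernCoeff h) q x y z w
      = fderiv ℝ (fun r => chernLow h r y z w) q x - fderiv ℝ (fun r => chernLow h r x z w) q y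
        - h q (chernCoeff h q x w) (chernCoeff h q y z)
        + h q (chernCoeff h q y w) (chernCoeff h q x z) := by
  have key := fun y z w : E => Filter.EventuallyEq.fderiv_eq (𝕜 := ℝ) (by
    filter_upwards [H.eventually_mem hq] with r hr using (H.chernLow_eq hr y z w))
  rw [H.curvatureLow_eq hq (A := chernCoeff h) (fun _ _ _ => rfl) (fun y z => ?_) (fun z => ?_) (fun x y z => ?_),
    key, key]
  · refine ((contDiffOn_clm_apply.2 fun w => ?_ : ContDiffOn ℝ ∞ _ U).contDiffAt
      (H.isOpen.mem_nhds hq)).differentiableAt (by simp)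
    exact (H.contDiffOn_chernLow y z w).congr fun r hr => H.chernLow_eq hr y z w
  · ext w
    rw [H.chernLow_eq hq]
    simp [chernLow]
  · rw [H.chernLow_eq hq, H.chernLow_eq hq, H.chernLow_metric hq]

lemma curvatureLow_bismutCoeff (x y z w : E) :
    curvatureLow h (bismutCoeff h) q x y z w
      = fderiv ℝ (fun r => bismutLow h r y z w) q x - fderiv ℝ (fun r => bismutLow h r x z w) q y
        - h q (bismutCoeff h q x w) (bismutCoeff h q y z)
        + h q (bismutCoeff h q y w) (bismutCoeff h q x z) := by
  have key := fun y z w : E => Filter.EventuallyEq.fderiv_eq (𝕜 := ℝ) (by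
    filter_upwards [H.eventually_mem hq] with r hr using (H.bismutLow_eq hr y z w))
  rw [H.curvatureLow_eq hq (A := bismutCoeff h) (fun _ _ _ => rfl) (fun y z => ?_) (fun z => ?_) (fun x y z => ?_),
    key, key]
  · refine ((contDiffOn_clm_apply.2 fun w => ?_ : ContDiffOn ℝ ∞ _ U).contDiffAt
      (H.isOpen.mem_nhds hq)).differentiableAt (by simp)
    exact (H.contDiffOn_bismutLow y z w).congr fun r hr => H.bismutLow_eq hr y z w
  · ext w
    rw [H.bismutLow_eq hq]
    simp [bismutLow, chernLow]
  · rw [H.bismutLow_eq hq, H.bismutLow_eq hq, H.bismutLow_metric hq]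

lemma torsionLow_bismutCoeff (x y z : E) :
    torsionLow h (bismutCoeff h) q x y z = dcLow h q x y z := by
  rw [torsionLow_eq, H.bismutCoeff_apply hq, H.bismutCoeff_apply hq, H.bismutLow_torsion hq]

lemma extDerivThree_torsionLow_bismutCoeff (x y z w : E) :
    extDerivThree (torsionLow h (bismutCoeff h)) q x y z w
      = fderiv ℝ (fun r => dcLow h r y z w) q x - fderiv ℝ (fun r => dcLow h r x z w) q y
        + fderiv ℝ (fun r => dcLow h r x y w) q z - fderiv ℝ (fun r => dcLow h r x y z) q w := by
  have key := fun y z w : E => Filter.EventuallyEq.fderiv_eq (𝕜 := ℝ) (by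
    filter_upwards [H.eventually_mem hq] with r hr using (H.torsionLow_bismutCoeff hr y z w))
  simp only [extDerivThree, key]

lemma torsionLow_chernCoeff (x y z : E) :
    torsionLow h (chernCoeff h) q x y z = chernLow h q x y z - chernLow h q y x z := by
  rw [torsionLow_eq, H.chernCoeff_apply hq, H.chernCoeff_apply hq]

end IsHermitianOn

end FlatCurvature

/-! ### Complex linearity of the coefficients and traces over orthonormal bases. -/

section FlatTraces

variable {E : Type*} [NormedAddCommGroup E] [NormedSpace ℂ E]

namespace IsHermitianOn

variable {h : E → E →L[ℝ] E →L[ℝ] ℝ} {U : Set E} (H : IsHermitianOn h U) {q : E} (hq : q ∈ U)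

include H hq

section Connection

variable [FiniteDimensional ℝ E]

/-- This is the fact that the Chern connection form is of type (1,0) in a holomorphic frame. The
Bismut connection has no such linearity in its direction slot. -/
lemma chernCoeff_mulI_left (x y : E) :
    chernCoeff h q (mulI E x) y = mulI E (chernCoeff h q x y) :=
  H.ext_low hq fun z => by
    rw [H.mulI_left hq, H.chernCoeff_apply hq, H.chernCoeff_apply hq, chernLow_mulI_left]

lemma chernCoeff_mulI_right (x y : E) :
    chernCoeff h q x (mulI E y) = mulI E (chernCoeff h q x y) :=
  H.ext_low hq fun z => by
    rw [H.mulI_left hq, H.chernCoeff_apply hq, H.chernCoeff_apply hq, H.chernLow_mulI_mid hq]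

/-- This expresses `∇J = 0`, as `J` is constant in the chart. -/
lemma bismutCoeff_mulI_right (x y : E) :
    bismutCoeff h q x (mulI E y) = mulI E (bismutCoeff h q x y) :=
  H.ext_low hq fun z => by
    rw [H.mulI_left hq, H.bismutCoeff_apply hq, H.bismutCoeff_apply hq]
    simp only [bismutLow, chernLow_mulI_left, H.chernLow_mulI_mid hq]
    ring

/-- `y ↦ ∇_x y - D_y x` is the `g`-adjoint of the endomorphism `C(x, ·)` given by the Chern
torsion. -/
lemma bismutCoeff_sub_chernCoeff_apply (x y z : E) :
    h q (bismutCoeff h q x y - chernCoeff h q y x) z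
      = torsionLow h (chernCoeff h) q x z y := by
  rw [H.torsionLow_chernCoeff hq, map_sub, sub_apply, H.bismutCoeff_apply hq,
    H.chernCoeff_apply hq]
  simp only [bismutLow]
  ring

/-- The part `D_y x` is complex linear in `x`, while the adjoint torsion part `∇_x y - D_y x` is
antilinear. The sign change is what separates the two in the quadratic terms. -/
lemma bismutCoeff_mulI_left (x y : E) :
    bismutCoeff h q (mulI E x) y = mulI E (chernCoeff h q y x)
      - mulI E (bismutCoeff h q x y - chernCoeff h q y x) := by
  refine H.ext_low hq fun z => ?_
  rw [map_sub, sub_apply, H.mulI_left hq, H.mulI_left hq, H.bismutCoeff_sub_chernCoeff_apply hq,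
    H.torsionLow_chernCoeff hq, H.bismutCoeff_apply hq, H.chernCoeff_apply hq]
  simp only [bismutLow, chernLow_mulI_left, H.chernLow_mulI_mid hq]
  ring

end Connection

variable {ι : Type*} [Fintype ι] [DecidableEq ι] (e : Module.Basis ι ℝ E)
  (he : ∀ i j, h q (e i) (e j) = if i = j then 1 else 0)

include he

omit H hq in
lemma sum_apply_smul (u : E) : ∑ i, h q u (e i) • e i = u := by
  have hr : ∀ j, h q u (e j) = e.repr u j := fun j => by
    conv_lhs => rw [← e.sum_repr u]
    simp [he, -Module.Basis.sum_repr]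
  simp only [hr, e.sum_repr]

omit H hq in
lemma sum_apply_mul_apply (u v : E) : ∑ i, h q u (e i) * h q v (e i) = h q u v := by
  conv_rhs => rw [← sum_apply_smul e he v]
  simp [mul_comm]

section Trace

variable {W : Type*} [NormedAddCommGroup W] [NormedSpace ℝ W]

/-- A metric trace does not depend on the orthonormal basis, and `J` is an isometry. Concretely, the
matrix of `J` is orthogonal, which is `hd`. -/
lemma sum_mulI_mulI (F : E →L[ℝ] E →L[ℝ] W) :
    ∑ i, F (mulI E (e i)) (mulI E (e i)) = ∑ i, F (e i) (e i) := by
  have hJ : ∀ i, mulI E (e i) = ∑ j, h q (mulI E (e i)) (e j) • e j := fun i =>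
    (sum_apply_smul e he _).symm
  have hd : ∀ j k, ∑ i, h q (mulI E (e i)) (e j) * h q (mulI E (e i)) (e k)
      = if j = k then 1 else 0 := by
    intro j k
    rw [← he, ← H.compat q hq, ← sum_apply_mul_apply e he]
    refine Finset.sum_congr rfl fun i _ => ?_
    rw [H.mulI_left hq, H.mulI_left hq, H.symm q hq (e i), H.symm q hq (e i)]
    ring
  calc ∑ i, F (mulI E (e i)) (mulI E (e i))
      = ∑ i, ∑ j, ∑ k, (h q (mulI E (e i)) (e j) * h q (mulI E (e i)) (e k)) • F (e j) (e k) := by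
        refine Finset.sum_congr rfl fun i _ => ?_
        conv_lhs => rw [hJ i]
        simp only [map_sum, map_smul, sum_apply, smul_apply,
          Finset.smul_sum, smul_smul]
        rw [Finset.sum_comm]
        simp only [mul_comm]
    _ = ∑ j, ∑ k, (∑ i, h q (mulI E (e i)) (e j) * h q (mulI E (e i)) (e k)) • F (e j) (e k) := by
        rw [Finset.sum_comm]
        refine Finset.sum_congr rfl fun j _ => ?_
        rw [Finset.sum_comm]
        simp only [Finset.sum_smul]
    _ = ∑ i, F (e i) (e i) := by simp [hd]

lemma sum_mulI_left (F : E →L[ℝ] E →L[ℝ] W) :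
    ∑ i, F (mulI E (e i)) (e i) = -∑ i, F (e i) (mulI E (e i)) := by
  have := H.sum_mulI_mulI hq e he (F.bilinearComp (.id ℝ E) (mulI E))
  simp at this
  rw [← this, neg_neg]

end Trace

/-! ### Traced curvatures and the cancellation. -/

variable [FiniteDimensional ℝ E]

/-- The mixed derivatives along `eᵢ` and `Jeᵢ` cancel by symmetry. The pure ones along `eᵢ` and
along `Jeᵢ` have equal traces. -/
lemma sum_curvatureLow_chernCoeff (x y : E) :
    (1 / 2) * ∑ i, curvatureLow h (chernCoeff h) q (e i) (mulI E (e i)) (mulI E x) y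
      = -(1 / 2) * ∑ i, fderiv ℝ (fderiv ℝ h) q (e i) (e i) x y
        + ∑ i, h q (chernCoeff h q (e i) x) (chernCoeff h q (e i) y) := by
  have h1 := congrArg (fun L : E →L[ℝ] E →L[ℝ] ℝ => L x y)
    (H.sum_mulI_mulI hq e he (fderiv ℝ (fderiv ℝ h) q))
  simp only [sum_apply] at h1
  have h2 : ∀ i, curvatureLow h (chernCoeff h) q (e i) (mulI E (e i)) (mulI E x) y
      = -(1 / 2) * fderiv ℝ (fderiv ℝ h) q (e i) (e i) x y
        - (1 / 2) * fderiv ℝ (fderiv ℝ h) q (mulI E (e i)) (mulI E (e i)) x y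
        + 2 * h q (chernCoeff h q (e i) x) (chernCoeff h q (e i) y) := by
    intro i
    rw [H.curvatureLow_chernCoeff hq]
    simp only [H.fderiv_chernLow hq, H.chernCoeff_mulI_left hq, H.chernCoeff_mulI_right hq,
      mulI_mulI, map_neg, neg_apply, H.sndFDeriv_compat hq, H.compat q hq,
      H.sndFDeriv_comm hq (mulI E (e i)) (e i)]
    rw [H.symm q hq (chernCoeff h q (e i) y)]
    ring
  simp only [h2, Finset.sum_add_distrib, Finset.sum_sub_distrib, ← Finset.mul_sum, h1]
  ring

omit [FiniteDimensional ℝ E] in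
lemma sum_fderiv_bismutLow (v x : E) :
    ∑ i, fderiv ℝ (fun r => bismutLow h r x (e i) (mulI E (e i))) q v
      = (1 / 2) * ∑ i, fderiv ℝ (fderiv ℝ h) q v (mulI E x) (e i) (e i)
        + 2 * ∑ i, fderiv ℝ (fderiv ℝ h) q v (e i) x (mulI E (e i)) := by
  have h1 := H.sum_mulI_left hq e he ((fderiv ℝ (fderiv ℝ h) q v).flip x)
  simp only [ContinuousLinearMap.flip_apply] at h1
  have h2 : ∀ i, fderiv ℝ (fun r => bismutLow h r x (e i) (mulI E (e i))) q v
      = (1 / 2) * fderiv ℝ (fderiv ℝ h) q v (mulI E x) (e i) (e i)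
        + fderiv ℝ (fderiv ℝ h) q v (e i) x (mulI E (e i))
        - fderiv ℝ (fderiv ℝ h) q v (mulI E (e i)) x (e i) := by
    intro i
    -- The form `h(·,J·)` is skew, and so are its derivatives.
    have h3 : fderiv ℝ (fderiv ℝ h) q v x (e i) (mulI E (e i)) = 0 := by
      have := H.sndFDeriv_symm hq v x (e i) (mulI E (e i))
      rw [H.sndFDeriv_mulI_left hq] at this
      linarith
    have h4 := H.sndFDeriv_symm hq v x (mulI E (e i)) (e i)
    simp only [H.fderiv_bismutLow hq, H.fderiv_chernLow hq, mulI_mulI, map_neg, neg_apply,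
      H.sndFDeriv_compat hq, h3, h4]
    ring
  simp only [h2, Finset.sum_add_distrib, Finset.sum_sub_distrib, ← Finset.mul_sum, h1]
  ring

/-- Since `∇J = 0`, the two quadratic terms of the curvature coincide, which absorbs the factor one
half. -/
lemma sum_curvatureLow_bismutCoeff (x y : E) :
    (1 / 2) * ∑ i, curvatureLow h (bismutCoeff h) q x y (e i) (mulI E (e i))
      = (1 / 4) * ∑ i, fderiv ℝ (fderiv ℝ h) q x (mulI E y) (e i) (e i)
        - (1 / 4) * ∑ i, fderiv ℝ (fderiv ℝ h) q y (mulI E x) (e i) (e i)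
        + ∑ i, fderiv ℝ (fderiv ℝ h) q x (e i) y (mulI E (e i))
        - ∑ i, fderiv ℝ (fderiv ℝ h) q y (e i) x (mulI E (e i))
        + ∑ i, h q (bismutCoeff h q x (e i)) (mulI E (bismutCoeff h q y (e i))) := by
  have h2 : ∀ i, curvatureLow h (bismutCoeff h) q x y (e i) (mulI E (e i))
      = fderiv ℝ (fun r => bismutLow h r y (e i) (mulI E (e i))) q x
        - fderiv ℝ (fun r => bismutLow h r x (e i) (mulI E (e i))) q y
        + 2 * h q (bismutCoeff h q x (e i)) (mulI E (bismutCoeff h q y (e i))) := by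
    intro i
    rw [H.curvatureLow_bismutCoeff hq, H.bismutCoeff_mulI_right hq, H.bismutCoeff_mulI_right hq,
      H.mulI_left hq, H.symm q hq (mulI E (bismutCoeff h q y (e i)))]
    ring
  simp only [h2, Finset.sum_add_distrib, Finset.sum_sub_distrib, ← Finset.mul_sum,
    H.sum_fderiv_bismutLow hq e he]
  ring

/-- Only second derivatives appear because `d^cΩ` involves no inverse metric. The trace lemmas merge
the `Jeᵢ` terms with the `eᵢ` terms, whence the factors 2. -/
lemma sum_extDerivThree_bismutCoeff (x y : E) :
    ∑ i, extDerivThree (torsionLow h (bismutCoeff h)) q (mulI E x) y (e i) (mulI E (e i))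
      = ∑ i, fderiv ℝ (fderiv ℝ h) q (mulI E x) (mulI E y) (e i) (e i)
        + ∑ i, fderiv ℝ (fderiv ℝ h) q x y (e i) (e i)
        + 2 * ∑ i, fderiv ℝ (fderiv ℝ h) q (e i) (e i) x y
        + 2 * ∑ i, fderiv ℝ (fderiv ℝ h) q (mulI E x) (e i) y (mulI E (e i))
        + 2 * ∑ i, fderiv ℝ (fderiv ℝ h) q (mulI E y) (e i) x (mulI E (e i))
        - 2 * ∑ i, fderiv ℝ (fderiv ℝ h) q x (e i) y (e i)
        - 2 * ∑ i, fderiv ℝ (fderiv ℝ h) q y (e i) x (e i) := by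
  have t1 := fun x y => H.sum_mulI_mulI hq e he ((fderiv ℝ (fderiv ℝ h) q x).flip y)
  have t2 := fun x y => H.sum_mulI_left hq e he ((fderiv ℝ (fderiv ℝ h) q x).flip y)
  simp only [ContinuousLinearMap.flip_apply] at t1 t2
  have t3 := congrArg (fun L : E →L[ℝ] E →L[ℝ] ℝ => L x y)
    (H.sum_mulI_mulI hq e he (fderiv ℝ (fderiv ℝ h) q))
  simp only [sum_apply] at t3
  have key : ∀ i, extDerivThree (torsionLow h (bismutCoeff h)) q (mulI E x) y (e i) (mulI E (e i))
      = fderiv ℝ (fderiv ℝ h) q (mulI E x) (mulI E y) (e i) (e i)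
        + fderiv ℝ (fderiv ℝ h) q x y (e i) (e i)
        + fderiv ℝ (fderiv ℝ h) q (e i) (e i) x y
        + fderiv ℝ (fderiv ℝ h) q (mulI E (e i)) (mulI E (e i)) x y
        + fderiv ℝ (fderiv ℝ h) q (mulI E x) (e i) y (mulI E (e i))
        - fderiv ℝ (fderiv ℝ h) q (mulI E x) (mulI E (e i)) y (e i)
        + fderiv ℝ (fderiv ℝ h) q (mulI E y) (e i) x (mulI E (e i))
        - fderiv ℝ (fderiv ℝ h) q (mulI E y) (mulI E (e i)) x (e i)
        - fderiv ℝ (fderiv ℝ h) q x (e i) y (e i)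
        - fderiv ℝ (fderiv ℝ h) q x (mulI E (e i)) y (mulI E (e i))
        - fderiv ℝ (fderiv ℝ h) q y (e i) x (e i)
        - fderiv ℝ (fderiv ℝ h) q y (mulI E (e i)) x (mulI E (e i)) := by
    intro i
    rw [H.extDerivThree_torsionLow_bismutCoeff hq]
    simp only [H.fderiv_dcLow hq, mulI_mulI, map_neg, neg_apply, H.sndFDeriv_compat hq,
      H.sndFDeriv_mulI_left hq, H.sndFDeriv_comm hq (e i) x, H.sndFDeriv_comm hq (e i) (mulI E y),
      H.sndFDeriv_comm hq (mulI E (e i)) x, H.sndFDeriv_comm hq (mulI E (e i)) (mulI E y),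
      H.sndFDeriv_comm hq y x]
    ring
  simp only [key, Finset.sum_add_distrib, Finset.sum_sub_distrib, t1, t2, t3]
  ring

/-- An endomorphism and its adjoint have transposed matrices in an orthonormal basis, so exchanging
the two sums passes from `C(x,·)` to its adjoint. -/
lemma sum_torsionLow_chernCoeff (x y : E) :
    ∑ i, ∑ j, torsionLow h (chernCoeff h) q x (e i) (e j)
        * torsionLow h (chernCoeff h) q y (e i) (e j)
      = ∑ i, h q (bismutCoeff h q x (e i) - chernCoeff h q (e i) x)
          (bismutCoeff h q y (e i) - chernCoeff h q (e i) y) := by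
  rw [Finset.sum_comm]
  refine Finset.sum_congr rfl fun i _ => ?_
  rw [← sum_apply_mul_apply e he]
  simp only [H.bismutCoeff_sub_chernCoeff_apply hq]

omit e he in
-- In the notation `A`, `S` this is `⟨A_x - S_x, A_y + S_y⟩ + ⟨A_x + S_x, A_y - S_y⟩`, evaluated at
-- `v`. The mixed products cancel.
lemma bismutCoeff_quadratic (x y v : E) :
    h q (bismutCoeff h q (mulI E x) v) (mulI E (bismutCoeff h q y v))
      + h q (bismutCoeff h q (mulI E (mulI E x)) v) (mulI E (bismutCoeff h q (mulI E y) v))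
      = 2 * h q (chernCoeff h q v x) (chernCoeff h q v y)
        - 2 * h q (bismutCoeff h q x v - chernCoeff h q v x)
          (bismutCoeff h q y v - chernCoeff h q v y) := by
  simp only [H.bismutCoeff_mulI_left hq, H.chernCoeff_mulI_right hq]
  simp only [map_sub, map_neg, sub_apply, neg_apply, mulI_mulI, H.compat q hq]
  ring

/-- The identity relating the Chern mean curvature, the Bismut Ricci form and the torsion, in a
holomorphic chart. -/
theorem meanCurvature_identity (x y : E) :
    (1 / 2) * ∑ i, curvatureLow h (chernCoeff h) q (e i) (mulI E (e i)) (mulI E x) y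
      = (1 / 2) * ((1 / 2) * ∑ i, curvatureLow h (bismutCoeff h) q (mulI E x) y (e i)
            (mulI E (e i))
          + (1 / 2) * ∑ i, curvatureLow h (bismutCoeff h) q (mulI E (mulI E x)) (mulI E y) (e i)
            (mulI E (e i)))
        + ∑ i, ∑ j, torsionLow h (chernCoeff h) q x (e i) (e j)
            * torsionLow h (chernCoeff h) q y (e i) (e j)
        - (1 / 4) * ∑ i, extDerivThree (torsionLow h (bismutCoeff h)) q (mulI E x) y (e i)
            (mulI E (e i)) := by
  have hq2 := Finset.sum_congr (rfl : (Finset.univ : Finset ι) = Finset.univ)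
    fun i _ => H.bismutCoeff_quadratic hq x y (e i)
  rw [Finset.sum_add_distrib, Finset.sum_sub_distrib, ← Finset.mul_sum, ← Finset.mul_sum] at hq2
  rw [H.sum_curvatureLow_chernCoeff hq e he, H.sum_curvatureLow_bismutCoeff hq e he,
    H.sum_curvatureLow_bismutCoeff hq e he, H.sum_extDerivThree_bismutCoeff hq e he,
    H.sum_torsionLow_chernCoeff hq e he]
  -- Solving for the sum at `(JJx, Jy)` lets it be eliminated; the sum at `(Jx, y)` then cancels.
  rw [← eq_sub_iff_add_eq'] at hq2
  rw [hq2]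
  -- With mixed partials put in a common order, the second-derivative terms cancel linearly.
  simp only [mulI_mulI, map_neg, neg_apply, H.sndFDeriv_compat hq, Finset.sum_neg_distrib,
    H.sndFDeriv_comm hq y x, H.sndFDeriv_comm hq (mulI E y) (mulI E x)]
  ring

end IsHermitianOn

end FlatTraces

/-! ### Passage from the manifold to a holomorphic chart. -/

section Chart

variable {E : Type*} [NormedAddCommGroup E] [NormedSpace ℂ E]

lemma contDiffGroupoid_restrictScalars {f : OpenPartialHomeomorph E E}
    (hf : f ∈ contDiffGroupoid ω 𝓘(ℂ, E)) : f ∈ contDiffGroupoid ∞ 𝓘(ℝ, E) := by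
  rw [contDiffGroupoid, mem_groupoid_of_pregroupoid] at hf ⊢
  simp only [contDiffPregroupoid, modelWithCornersSelf_coe, modelWithCornersSelf_coe_symm,
    Function.comp_id, Function.id_comp, Set.preimage_id, Set.range_id, Set.inter_univ] at hf ⊢
  exact ⟨(hf.1.restrict_scalars ℝ).of_le le_top, (hf.2.restrict_scalars ℝ).of_le le_top⟩

variable {M : Type*} [TopologicalSpace M] [ChartedSpace E M]

lemma maximalAtlas_restrictScalars {φ : OpenPartialHomeomorph M E}
    (hφ : φ ∈ IsManifold.maximalAtlas 𝓘(ℂ, E) ω M) :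
    φ ∈ IsManifold.maximalAtlas 𝓘(ℝ, E) ∞ M := fun e' he' =>
  ⟨contDiffGroupoid_restrictScalars (hφ e' he').1, contDiffGroupoid_restrictScalars (hφ e' he').2⟩

lemma hasMFDerivAt_restrictScalars {M' : Type*} [TopologicalSpace M'] [ChartedSpace E M']
    {f : M → M'} {x : M} {f' : E →L[ℂ] E} (hf : HasMFDerivAt 𝓘(ℂ, E) 𝓘(ℂ, E) f x f') :
    HasMFDerivAt 𝓘(ℝ, E) 𝓘(ℝ, E) f x (f'.restrictScalars ℝ) :=
  ⟨hf.1, HasFDerivWithinAt.restrictScalars ℝ hf.2⟩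

/-- The real derivative of a holomorphic map commutes with the complex structures. -/
lemma mfderiv_mulI {M' : Type*} [TopologicalSpace M'] [ChartedSpace E M']
    {f : M → M'} {x : M} (hf : MDifferentiableAt 𝓘(ℂ, E) 𝓘(ℂ, E) f x) (u : E) :
    (mfderiv 𝓘(ℝ, E) 𝓘(ℝ, E) f x : E →L[ℝ] E) (mulI E u)
      = mulI E ((mfderiv 𝓘(ℝ, E) 𝓘(ℝ, E) f x : E →L[ℝ] E) u) := by
  let f' : E →L[ℂ] E := mfderiv 𝓘(ℂ, E) 𝓘(ℂ, E) f x
  have h1 : mfderiv 𝓘(ℝ, E) 𝓘(ℝ, E) f x = f'.restrictScalars ℝ :=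
    (hasMFDerivAt_restrictScalars hf.hasMFDerivAt).mfderiv
  rw [h1]
  exact f'.map_smul Complex.I u

/-- The metric of the tangent space at `y`, on representatives in the preferred chart at `y`. -/
def metricAt [IsManifold 𝓘(ℂ, E) ω M] (g : HermitianMetric E M) (y : M) :
    E →L[ℝ] E →L[ℝ] ℝ :=
  g.toRiemannianMetric.inner y

/-- The derivative of the inverse of the chart `φ`, on representatives. -/
def symmDeriv (φ : OpenPartialHomeomorph M E) (p : E) : E →L[ℝ] E :=
  mfderiv 𝓘(ℝ, E) 𝓘(ℝ, E) φ.symm p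

lemma coordMetric_apply [IsManifold 𝓘(ℂ, E) ω M] (g : HermitianMetric E M)
    (φ : OpenPartialHomeomorph M E) (p u v : E) :
    coordMetric g φ p u v = metricAt g (φ.symm p) (symmDeriv φ p u) (symmDeriv φ p v) := rfl

variable [IsManifold 𝓘(ℂ, E) ω M] {φ : OpenPartialHomeomorph M E}
  (hφ : φ ∈ IsManifold.maximalAtlas 𝓘(ℂ, E) ω M)

include hφ

omit [IsManifold 𝓘(ℂ, E) ω M] in
lemma mdifferentiable_complex : φ.MDifferentiable 𝓘(ℂ, E) 𝓘(ℂ, E) :=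
  ⟨(contMDiffOn_of_mem_maximalAtlas hφ).mdifferentiableOn (by simp),
    (contMDiffOn_symm_of_mem_maximalAtlas hφ).mdifferentiableOn (by simp)⟩

omit [IsManifold 𝓘(ℂ, E) ω M] in
lemma mdifferentiable_real : φ.MDifferentiable 𝓘(ℝ, E) 𝓘(ℝ, E) :=
  ⟨(contMDiffOn_of_mem_maximalAtlas (maximalAtlas_restrictScalars hφ)).mdifferentiableOn
      (by simp),
    (contMDiffOn_symm_of_mem_maximalAtlas (maximalAtlas_restrictScalars hφ)).mdifferentiableOn
      (by simp)⟩

omit [IsManifold 𝓘(ℂ, E) ω M] in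
lemma coord_J {x : M} (hx : x ∈ φ.source) (X : TangentSpace 𝓘(ℝ, E) x) :
    coord φ x (J x X) = mulI E (coord φ x X) :=
  mfderiv_mulI ((mdifferentiable_complex hφ).mdifferentiableAt hx) X

omit [IsManifold 𝓘(ℂ, E) ω M] in
lemma mfderiv_bijective {x : M} (hx : x ∈ φ.source) :
    Function.Bijective (mfderiv 𝓘(ℝ, E) 𝓘(ℝ, E) φ x) :=
  (mdifferentiable_real hφ).mfderiv_bijective hx

omit [IsManifold 𝓘(ℂ, E) ω M] in
lemma symmDeriv_mulI {p : E} (hp : p ∈ φ.target) (u : E) :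
    symmDeriv φ p (mulI E u) = mulI E (symmDeriv φ p u) :=
  mfderiv_mulI ((mdifferentiable_complex hφ).mdifferentiableAt_symm hp) u

omit [IsManifold 𝓘(ℂ, E) ω M] in
lemma symmDeriv_injective {p : E} (hp : p ∈ φ.target) : Function.Injective (symmDeriv φ p) :=
  ((mdifferentiable_real hφ).symm.mfderiv_bijective hp).1

omit [IsManifold 𝓘(ℂ, E) ω M] in
lemma symmDeriv_coord {x : M} (hx : x ∈ φ.source) (X : TangentSpace 𝓘(ℝ, E) x) :
    symmDeriv φ (φ x) (coord φ x X) = X :=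
  DFunLike.congr_fun ((mdifferentiable_real hφ).symm_comp_deriv hx) X

variable (g : HermitianMetric E M)

lemma coordMetric_coord {x : M} (hx : x ∈ φ.source) (X Y : TangentSpace 𝓘(ℝ, E) x) :
    coordMetric g φ (φ x) (coord φ x X) (coord φ x Y) = g.inner x X Y := by
  rw [coordMetric_apply, symmDeriv_coord hφ hx, symmDeriv_coord hφ hx, φ.left_inv hx]
  rfl

/-- In finite dimension smoothness can be tested on fixed vectors `u`, `v`. Pushed forward by
`φ.symm`, these are smooth along `φ.symm`, and a smooth metric pairs them smoothly. -/
lemma contDiffOn_coordMetric [FiniteDimensional ℝ E] :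
    ContDiffOn ℝ ∞ (coordMetric g φ) φ.target := by
  have hsymm : ContMDiffOn 𝓘(ℝ, E) 𝓘(ℝ, E) ∞ φ.symm φ.target :=
    contMDiffOn_symm_of_mem_maximalAtlas (maximalAtlas_restrictScalars hφ)
  have : IsManifold 𝓘(ℝ, E) 1 M := .of_le (n := ∞) (by simp)
  have hvec : ∀ u : E, ContMDiffOn 𝓘(ℝ, E) (𝓘(ℝ, E).prod 𝓘(ℝ, E)) ∞
      (fun p => (⟨φ.symm p, mfderiv 𝓘(ℝ, E) 𝓘(ℝ, E) φ.symm p u⟩ : TangentBundle 𝓘(ℝ, E) M))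
      φ.target := by
    intro u
    have h1 := hsymm.contMDiffOn_tangentMapWithin (m := ∞) (by simp)
      φ.open_target.uniqueMDiffOn
    have h2 : ContMDiffOn 𝓘(ℝ, E) (𝓘(ℝ, E).prod 𝓘(ℝ, E)) ∞
        (fun p => (⟨p, u⟩ : TangentBundle 𝓘(ℝ, E) E)) φ.target := fun p _ =>
      contMDiffWithinAt_vectorSpace_iff_contDiffWithinAt.2 contDiffWithinAt_const
    refine (h1.comp h2 fun p hp => hp).congr fun p hp => ?_
    rw [Function.comp_apply, tangentMapWithin_eq_tangentMap
      (φ.open_target.uniqueMDiffOn _ hp) ((mdifferentiable_real hφ).mdifferentiableAt_symm hp)]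
    rfl
  refine contDiffOn_clm_apply.2 fun u => contDiffOn_clm_apply.2 fun v => ?_
  have h3 := ContMDiffOn.clm_bundle_apply₂ (E₃ := fun _ : M => ℝ) (F₃ := ℝ)
    (g.toRiemannianMetric.contMDiff.comp_contMDiffOn hsymm) (hvec u) (hvec v)
  exact fun p hp => ((Bundle.contMDiffWithinAt_totalSpace.1 (h3 p hp)).2).contDiffWithinAt

lemma isHermitianOn_coordMetric [FiniteDimensional ℝ E] :
    IsHermitianOn (coordMetric g φ) φ.target where
  isOpen := φ.open_target
  contDiffOn := contDiffOn_coordMetric hφ g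
  symm q _ u v := by
    rw [coordMetric_apply, coordMetric_apply]
    exact g.toRiemannianMetric.symm (φ.symm q) _ _
  compat q hq u v := by
    rw [coordMetric_apply, coordMetric_apply, symmDeriv_mulI hφ hq, symmDeriv_mulI hφ hq]
    exact g.compatible (φ.symm q) _ _
  pos q hq u hu := by
    rw [coordMetric_apply]
    refine g.toRiemannianMetric.pos (φ.symm q) _ fun h0 => hu ?_
    exact symmDeriv_injective hφ hq (h0.trans (map_zero (symmDeriv φ q)).symm)

end Chart

end Hermitian

end

theorem mainTheorem12 {E : Type*} [NormedAddCommGroup E] [NormedSpace ℂ E] [FiniteDimensional ℂ E]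
    {M : Type*} [TopologicalSpace M] [ChartedSpace E M] [IsManifold 𝓘(ℂ, E) ω M]
    (g : Hermitian.HermitianMetric E M)
    (φ : OpenPartialHomeomorph M E) (hφ : φ ∈ IsManifold.maximalAtlas 𝓘(ℂ, E) ω M)
    (x : M) (hx : x ∈ φ.source)
    {ι : Type*} [Fintype ι] [DecidableEq ι] (e : Module.Basis ι ℝ (TangentSpace 𝓘(ℝ, E) x))
    (he : ∀ i j, g.inner x (e i) (e j) = if i = j then 1 else 0)
    (X Y : TangentSpace 𝓘(ℝ, E) x) :
    Hermitian.meanCurvature g φ e (Hermitian.J x X) Y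
      = Hermitian.bismutRicciForm11 g φ e (Hermitian.J x X) Y
        + Hermitian.torsionInner g φ e X Y
        - (1 / 4) * Hermitian.lambdaForm g φ e (Hermitian.J x X) Y := by
  have : FiniteDimensional ℝ E := FiniteDimensional.complexToReal E
  -- The differential of `φ` carries `e` to a basis that is orthonormal for the coordinate metric at
  -- `φ x`.
  let L : TangentSpace 𝓘(ℝ, E) x ≃ₗ[ℝ] E :=
    LinearEquiv.ofBijective (mfderiv 𝓘(ℝ, E) 𝓘(ℝ, E) φ x).toLinearMap
      (Hermitian.mfderiv_bijective hφ hx)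
  have hb : ∀ i, e.map L i = Hermitian.coord φ x (e i) := fun i => e.map_apply L i
  have key := (Hermitian.isHermitianOn_coordMetric hφ g).meanCurvature_identity
    (φ.map_source hx) (e.map L)
    (fun i j => by rw [hb, hb, Hermitian.coordMetric_coord hφ g hx, he])
    (Hermitian.coord φ x X) (Hermitian.coord φ x Y)
  simp only [hb] at key
  simpa only [Hermitian.meanCurvature, Hermitian.bismutRicciForm11, Hermitian.bismutRicciForm,
    Hermitian.torsionInner, Hermitian.lambdaForm, Hermitian.chernCurvature,
    Hermitian.bismutCurvature, Hermitian.chernTorsion, Hermitian.dBismutTorsion,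
    Hermitian.coord_J hφ hx] using key
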